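/- Let $k$ be a field, $K$ a finite extension field of $k$, $\Lambda$ a (unital, associative, not necessarily commutative or finite-dimensional) $k$-algebra, and $\Gamma = K\otimes_k\Lambda$. For a $k$-algebra $R$ let $\operatorname{mod} R$ denote the class of (left) $R$-modules that are finite-dimensional over $k$; for $M,N\in\operatorname{mod}R$ write $M\simeq^R N$ if $M$ and $N$ are isomorphic as $R$-modules, and $M\leq_{\mathrm{Hom}}^R N$ if $\dim_k\operatorname{Hom}_R(X,M)\leq\dim_k\operatorname{Hom}_R(X,N)$ for all $X\in\operatorname{mod}R$. Every $\Gamma$-module is regarded as a $\Lambda$-module along the ring homomorphism $\Lambda\to\Gamma$, $\lambda\mapsto 1\otimes\lambda$. Then the following are equivalent: 1. $M\simeq^\Lambda N\iff M\simeq^\Gamma N$ for all $M,N\in\operatorname{mod}\Gamma$; 2. $M\leq_{\mathrm{Hom}}^\Lambda N\iff M\leq_{\mathrm{Hom}}^\Gamma N$ for all $M,N\in\operatorname{mod}\Gamma$. -/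

import Mathlib

open scoped TensorProduct

universe u v w

/-- An object of `mod R` for an algebra `R` over a field `k`: a (left, unital) `R`-module whose
underlying `k`-vector space is finite-dimensional. The `k`-vector space structure is the one induced
by `R`, as expressed by the scalar tower condition `(c • r) • m = c • (r • m)`. -/
structure FDModule (k : Type*) (R : Type*) [Field k] [Ring R] [Algebra k R] where
  /-- the underlying set of the module -/
  carrier : Type*
  [addCommGroup : AddCommGroup carrier]
  [moduleBase : Module k carrier]
  [module : Module R carrier]
  [isScalarTower : IsScalarTower k R carrier]
  [finiteDimensional : FiniteDimensional k carrier]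

namespace FDModule

attribute [instance] FDModule.addCommGroup FDModule.moduleBase FDModule.module
  FDModule.isScalarTower FDModule.finiteDimensional

section

variable {k : Type*} {R : Type*} {S : Type*} [Field k] [Ring R] [Algebra k R]
  [Ring S] [Algebra k S]

/-- Isomorphism of finite-dimensional `R`-modules. -/
def Iso (M N : FDModule k R) : Prop :=
  Nonempty (M.carrier ≃ₗ[R] N.carrier)

/-- The dimension over `k` of the space of `R`-module homomorphisms from `M` to `N`. -/
noncomputable def homDim (M N : FDModule k R) : ℕ :=
  Module.finrank k (M.carrier →ₗ[R] N.carrier)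

/-- The Hom-order on finite-dimensional `R`-modules: `M ≤ N` if `dim Hom(X, M) ≤ dim Hom(X, N)`
for every finite-dimensional `R`-module `X`. -/
def HomLE {k : Type u} {R : Type v} [Field k] [Ring R] [Algebra k R]
    (M N : FDModule.{u, v, w} k R) : Prop :=
  ∀ X : FDModule.{u, v, w} k R, homDim X M ≤ homDim X N

/-- Restriction of an `S`-module along a homomorphism of `k`-algebras `f : R → S`: the same
`k`-vector space, with `r • m = f r • m`. -/
def restrict (f : R →ₐ[k] S) (M : FDModule k S) : FDModule k R :=
  letI : Module R M.carrier := Module.compHom M.carrier f.toRingHom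
  { carrier := M.carrier
    isScalarTower := ⟨fun c r m => by
      change f (c • r) • m = c • (f r • m)
      rw [map_smul, smul_assoc]⟩ }

end

/-- A finite-dimensional `K ⊗ Λ`-module viewed as a `Λ`-module along `l ↦ 1 ⊗ l`. -/
def toBase {k K Λ : Type*} [Field k] [Field K] [Algebra k K] [Ring Λ] [Algebra k Λ]
    (M : FDModule k (K ⊗[k] Λ)) : FDModule k Λ :=
  M.restrict (Algebra.TensorProduct.includeRight : Λ →ₐ[k] K ⊗[k] Λ)

end FDModule

/-!
Write `Γ = K ⊗ Λ` and `d = [K : k]`. Two facts carry the equivalence.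

The first concerns induction `X ↦ K ⊗ X` from `Λ`-modules to `Γ`-modules. It is left adjoint to
restriction (`FDModule.homDim_induce`), so the Hom-order over `Γ` always implies the one over `Λ`. If
`X` is itself a `Γ`-module, then `K ⊗ X` and `X ^ d` are isomorphic over `Λ`
(`FDModule.iso_toBase_induce`). When isomorphism over `Λ` implies isomorphism over `Γ`, they are
isomorphic over `Γ`, which gives `dim Hom_Λ(X, M) = dim Hom_Γ(K ⊗ X, M) = d * dim Hom_Γ(X, M)`. Hence
the Hom-order over `Λ` implies the one over `Γ`.

The second is the theorem of Auslander and Bongartz that a finite-dimensional module `M` is determined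
by the function `X ↦ dim Hom(X, M)` (`FDModule.iso_of_homDim_eq`); in other words, the Hom-order is
antisymmetric up to isomorphism. Modules that are isomorphic over `Λ` are comparable in both directions
over `Λ`; if this passes to `Γ`, they are isomorphic over `Γ`. The theorem itself is proved by showing
that `M` is a direct summand of a power of `N` (`FDModule.exists_split`), so that `M` and `N` have a
common indecomposable summand (`exists_common_summand`), which is split off.
-/

/-! ### Indecomposable summands and Fitting's lemma -/

section Fitting

variable {R U : Type*} [Ring R] [AddCommGroup U] [Module R U]

/-- By Fitting's lemma `U` is the direct sum of the kernel and the range of a high power of `f`. -/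
theorem Module.End.isNilpotent_or_isUnit_of_indecomposable [IsNoetherian R U] [IsArtinian R U]
    (hU : ∀ A B : Submodule R U, IsCompl A B → A = ⊥ ∨ B = ⊥) (f : Module.End R U) :
    IsNilpotent f ∨ IsUnit f := by
  -- A positive exponent is needed for injectivity of `f ^ n` to give injectivity of `f`.
  obtain ⟨n, hn, hc⟩ := (f.eventually_isCompl_ker_pow_range_pow.and
    (Filter.eventually_ge_atTop 1)).exists.imp fun _ h => h.symm
  rcases hU _ _ hc with h | h
  · right
    have hinj : Function.Injective f := by
      have : Function.Injective (f ^ n) := LinearMap.ker_eq_bot.mp h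
      obtain ⟨m, rfl⟩ := Nat.exists_eq_succ_of_ne_zero (Nat.one_le_iff_ne_zero.mp hn)
      rw [pow_succ, Module.End.mul_eq_comp, LinearMap.coe_comp] at this
      exact this.of_comp
    exact (Module.End.isUnit_iff f).mpr (IsArtinian.bijective_of_injective_endomorphism f hinj)
  · left
    exact ⟨n, LinearMap.range_eq_bot.mp h⟩

theorem Module.End.isLocalRing_of_indecomposable [IsNoetherian R U] [IsArtinian R U] [Nontrivial U]
    (hU : ∀ A B : Submodule R U, IsCompl A B → A = ⊥ ∨ B = ⊥) :
    IsLocalRing (Module.End R U) :=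
  .of_isUnit_or_isUnit_one_sub_self fun f =>
    (isNilpotent_or_isUnit_of_indecomposable hU f).symm.imp_right IsNilpotent.isUnit_one_sub

/-- A nonzero direct summand that is minimal among all such is indecomposable. -/
theorem exists_indecomposable_summand (R M : Type*) [Ring R] [AddCommGroup M] [Module R M]
    [IsArtinian R M] [Nontrivial M] :
    ∃ U V : Submodule R M, IsCompl U V ∧ U ≠ ⊥ ∧
      ∀ A B : Submodule R U, IsCompl A B → A = ⊥ ∨ B = ⊥ := by
  obtain ⟨U, ⟨hU, V, hV⟩, hmin⟩ := IsArtinian.set_has_minimal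
    {U : Submodule R M | U ≠ ⊥ ∧ ∃ V, IsCompl U V} ⟨⊤, top_ne_bot, ⊥, isCompl_top_bot⟩
  refine ⟨U, V, hV, hU, fun A B hAB => ?_⟩
  by_contra! h
  -- If `U = A ⊕ B` with `A` and `B` nonzero, then `A` is a smaller nonzero summand of `M`.
  refine hmin (A.map U.subtype) ⟨?_, B.map U.subtype ⊔ V, ?_⟩ ?_
  · exact fun h0 => h.1 (Submodule.map_injective_of_injective U.subtype_injective
      (h0.trans (Submodule.map_bot _).symm))
  · have hd : Disjoint (A.map U.subtype) (B.map U.subtype) :=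
      (Submodule.disjoint_map U.subtype_injective) hAB.disjoint
    have hs : A.map U.subtype ⊔ B.map U.subtype = U := by
      rw [← Submodule.map_sup, hAB.sup_eq_top, Submodule.map_subtype_top]
    constructor
    · apply Disjoint.disjoint_sup_right_of_disjoint_sup_left hd
      rw [hs]; exact hV.disjoint
    · rw [codisjoint_iff, ← sup_assoc, hs, hV.sup_eq_top]
  · refine lt_of_le_of_ne (Submodule.map_subtype_le _ _) fun he => h.2 ?_
    have hA : A = ⊤ := by
      apply Submodule.map_injective_of_injective U.subtype_injective
      rw [he, Submodule.map_subtype_top]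
    exact disjoint_top.mp (hA ▸ hAB.disjoint.symm)

theorem LinearMap.nonempty_equiv_prod_ker_of_isUnit_comp {N : Type*} [AddCommGroup N] [Module R N]
    (i : U →ₗ[R] N) (p : N →ₗ[R] U) (h : IsUnit (p ∘ₗ i : Module.End R U)) :
    Nonempty (N ≃ₗ[R] U × LinearMap.ker p) := by
  have hb : Function.Bijective (p ∘ₗ i) := (Module.End.isUnit_iff _).mp h
  refine ⟨(LinearEquiv.ofBijective (i.coprod (LinearMap.ker p).subtype) ⟨?_, fun y => ?_⟩).symm⟩
  · rw [← LinearMap.ker_eq_bot, LinearMap.ker_eq_bot']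
    rintro ⟨x, y, hy⟩ hxy
    simp only [LinearMap.coprod_apply, Submodule.subtype_apply] at hxy
    have hx : x = 0 := by
      apply hb.1
      have := congrArg p hxy
      simpa [LinearMap.mem_ker.mp hy] using this
    subst hx
    simpa using hxy
  · obtain ⟨x, hx⟩ := hb.2 (p y)
    refine ⟨(x, ⟨y - i x, ?_⟩), by simp⟩
    simp only [LinearMap.coe_comp, Function.comp_apply] at hx
    simp [hx]

/-- If `M` is a direct summand of a finite power of `N`, then `M` and `N` have a nonzero direct
summand in common. For an indecomposable summand `U` of `M` the identity of `U` is a sum of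
endomorphisms that factor through `N`; the endomorphism ring of `U` is local, so one of these
endomorphisms is invertible. -/
theorem exists_common_summand {M N ι : Type*} [Fintype ι]
    [AddCommGroup M] [Module R M] [AddCommGroup N] [Module R N]
    [IsNoetherian R M] [IsArtinian R M] [Nontrivial M]
    (f : M →ₗ[R] ι → N) (g : (ι → N) →ₗ[R] M) (hgf : g ∘ₗ f = LinearMap.id) :
    ∃ (U V : Submodule R M) (W : Submodule R N), U ≠ ⊥ ∧
      Nonempty (M ≃ₗ[R] U × V) ∧ Nonempty (N ≃ₗ[R] U × W) := by
  classical
  obtain ⟨U, V, hUV, hU, hind⟩ := exists_indecomposable_summand R M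
  have : Nontrivial U := Submodule.nontrivial_iff_ne_bot.mpr hU
  let q : M →ₗ[R] U := U.projectionOnto V hUV
  let a : ι → N →ₗ[R] U := fun i => q ∘ₗ g ∘ₗ LinearMap.single R (fun _ => N) i
  let b : ι → U →ₗ[R] N := fun i => LinearMap.proj i ∘ₗ f ∘ₗ U.subtype
  have hsum : ∑ i, (a i ∘ₗ b i : Module.End R U) = 1 := by
    ext1 x
    have h1 : ∑ i, LinearMap.single R (fun _ => N) i (f x i) = f x := by
      simpa using Finset.univ_sum_single (f (x : M))
    have h2 : g (f x) = x := LinearMap.congr_fun hgf x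
    simp only [LinearMap.sum_apply, a, b, LinearMap.comp_apply, LinearMap.proj_apply,
      Submodule.subtype_apply, Module.End.one_apply]
    rw [← map_sum, ← map_sum, h1, h2]
    exact Submodule.projectionOnto_apply_left hUV x
  have := Module.End.isLocalRing_of_indecomposable hind
  obtain ⟨i, -, hi⟩ := IsLocalRing.exists_of_isUnit_sum (hsum ▸ isUnit_one)
  exact ⟨U, V, LinearMap.ker (a i), hU, ⟨(Submodule.prodEquivOfIsCompl U V hUV).symm⟩,
    LinearMap.nonempty_equiv_prod_ker_of_isUnit_comp _ _ hi⟩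

end Fitting

/-! ### Modules are determined by dimensions of Hom spaces -/

section Bongartz

variable {k R : Type*} [Field k] [Ring R] [Algebra k R]

instance finiteDimensional_hom {M N : Type*}
    [AddCommGroup M] [Module k M] [Module R M] [IsScalarTower k R M] [FiniteDimensional k M]
    [AddCommGroup N] [Module k N] [Module R N] [IsScalarTower k R N] [FiniteDimensional k N] :
    FiniteDimensional k (M →ₗ[R] N) :=
  Module.Finite.of_injective (LinearMap.restrictScalarsₗ k R M N k)
    (LinearMap.restrictScalars_injective k)

instance finiteDimensional_submodule {M : Type*}
    [AddCommGroup M] [Module k M] [Module R M] [IsScalarTower k R M] [FiniteDimensional k M]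
    (U : Submodule R M) : FiniteDimensional k U :=
  Module.Finite.of_injective (U.subtype.restrictScalars k) U.subtype_injective

theorem finrank_pi_hom {ι M N : Type*} [Fintype ι]
    [AddCommGroup M] [Module k M] [Module R M] [IsScalarTower k R M] [FiniteDimensional k M]
    [AddCommGroup N] [Module k N] [Module R N] [IsScalarTower k R N] [FiniteDimensional k N] :
    Module.finrank k ((ι → M) →ₗ[R] N) = Fintype.card ι * Module.finrank k (M →ₗ[R] N) := by
  classical
  rw [← (LinearMap.lsum R (fun _ : ι => M) k).finrank_eq, Module.finrank_pi_fintype]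
  simp

theorem finrank_hom_congr {X M N : Type*}
    [AddCommGroup X] [Module R X]
    [AddCommGroup M] [Module k M] [Module R M] [IsScalarTower k R M]
    [AddCommGroup N] [Module k N] [Module R N] [IsScalarTower k R N] (e : M ≃ₗ[R] N) :
    Module.finrank k (X →ₗ[R] M) = Module.finrank k (X →ₗ[R] N) :=
  LinearEquiv.finrank_eq
    { toFun := fun φ => e.toLinearMap ∘ₗ φ
      invFun := fun φ => e.symm.toLinearMap ∘ₗ φ
      map_add' := fun φ ψ => LinearMap.comp_add _ _ _
      map_smul' := fun c φ => by
        ext1 x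
        exact (e.restrictScalars k).map_smul c (φ x)
      left_inv := fun φ => by ext; simp
      right_inv := fun φ => by ext1; simp }

/-- Rank-nullity for `Hom(N, P) → Hom(M, P)`, whose kernel is `Hom(coker f, P)` by the left
exactness of `Hom(-, P)`. -/
theorem finrank_range_lcomp_add {M N P : Type*}
    [AddCommGroup M] [Module k M] [Module R M] [IsScalarTower k R M] [FiniteDimensional k M]
    [AddCommGroup N] [Module k N] [Module R N] [IsScalarTower k R N] [FiniteDimensional k N]
    [AddCommGroup P] [Module k P] [Module R P] [IsScalarTower k R P] [FiniteDimensional k P]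
    (f : M →ₗ[R] N) :
    Module.finrank k (LinearMap.range (LinearMap.lcomp k P f)) +
      Module.finrank k ((N ⧸ LinearMap.range f) →ₗ[R] P) = Module.finrank k (N →ₗ[R] P) := by
  rw [← LinearMap.finrank_range_add_finrank_ker (LinearMap.lcomp k P f)]
  congr 1
  have hinj : Function.Injective (LinearMap.lcomp k P (LinearMap.range f).mkQ) :=
    fun a b h => Submodule.linearMap_qext _ h
  have hrange : LinearMap.range (LinearMap.lcomp k P (LinearMap.range f).mkQ) =
      LinearMap.ker (LinearMap.lcomp k P f) := by
    ext g
    constructor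
    · rintro ⟨h, rfl⟩
      ext x
      change h (Submodule.Quotient.mk (f x)) = 0
      rw [(Submodule.Quotient.mk_eq_zero _).mpr (LinearMap.mem_range_self f x), map_zero]
    · intro h
      refine ⟨(LinearMap.range f).liftQ g ?_, rfl⟩
      rintro _ ⟨x, rfl⟩
      exact LinearMap.congr_fun h x
  rw [← hrange, LinearMap.finrank_range_of_inj hinj]

namespace FDModule

variable {k : Type u} {R : Type v} [Field k] [Ring R] [Algebra k R]

/-- If `dim Hom(X, M) = dim Hom(X, N)` for all `X`, then `M` is a direct summand of a power of `N`.
The splitting map is the map `f : M → N ^ n` whose components form a basis of `Hom(M, N)`. Composition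
with `f` is surjective from `Hom(N ^ n, N)` onto `Hom(M, N)` by the choice of `f`. Comparing dimensions
along `M → N ^ n → coker f → 0` shows that it is also surjective from `Hom(N ^ n, M)` onto
`Hom(M, M)`, so the identity of `M` factors through `f`. -/
theorem exists_split (M N : FDModule.{u, v, w} k R)
    (h : ∀ X : FDModule.{u, v, w} k R, homDim X M = homDim X N) :
    ∃ (n : ℕ) (f : M.carrier →ₗ[R] Fin n → N.carrier) (g : (Fin n → N.carrier) →ₗ[R] M.carrier),
      g ∘ₗ f = LinearMap.id := by
  let b := Module.finBasis k (M.carrier →ₗ[R] N.carrier)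
  let f : M.carrier →ₗ[R] Fin (homDim M N) → N.carrier := LinearMap.pi b
  have hN : LinearMap.range (LinearMap.lcomp k N.carrier f) = ⊤ := by
    rw [← top_le_iff, ← b.span_eq, Submodule.span_le]
    rintro _ ⟨i, rfl⟩
    exact ⟨LinearMap.proj i, rfl⟩
  have eN := finrank_range_lcomp_add (k := k) (P := N.carrier) f
  have eM := finrank_range_lcomp_add (k := k) (P := M.carrier) f
  have hC : Module.finrank k (((Fin (homDim M N) → N.carrier) ⧸ LinearMap.range f) →ₗ[R] M.carrier)
      = Module.finrank k (((Fin (homDim M N) → N.carrier) ⧸ LinearMap.range f) →ₗ[R] N.carrier) :=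
    h (FDModule.mk ((Fin (homDim M N) → N.carrier) ⧸ LinearMap.range f))
  have hNN : Module.finrank k (N.carrier →ₗ[R] M.carrier) =
    Module.finrank k (N.carrier →ₗ[R] N.carrier) := h N
  have hMM : Module.finrank k (M.carrier →ₗ[R] M.carrier) =
    Module.finrank k (M.carrier →ₗ[R] N.carrier) := h M
  rw [hN, finrank_top, finrank_pi_hom] at eN
  rw [finrank_pi_hom] at eM
  have hM : LinearMap.range (LinearMap.lcomp k M.carrier f) = ⊤ := by
    apply Submodule.eq_top_of_finrank_eq
    rw [hNN, ← eN, hC] at eM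
    rw [hMM]
    exact Nat.add_right_cancel eM
  obtain ⟨g, hg⟩ := LinearMap.range_eq_top.mp hM LinearMap.id
  exact ⟨_, f, g, hg⟩

theorem homDim_eq_add {M : FDModule.{u, v, w} k R} {U V : Type w}
    [AddCommGroup U] [Module k U] [Module R U] [IsScalarTower k R U] [FiniteDimensional k U]
    [AddCommGroup V] [Module k V] [Module R V] [IsScalarTower k R V] [FiniteDimensional k V]
    (e : M.carrier ≃ₗ[R] U × V) (X : FDModule.{u, v, w} k R) :
    homDim X M = homDim X (FDModule.mk U) + homDim X (FDModule.mk V) := by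
  unfold homDim
  rw [← Module.finrank_prod,
    (LinearMap.prodEquiv (R := R) (M := X.carrier) (M₂ := U) (M₃ := V) k).finrank_eq]
  exact finrank_hom_congr e

/-- A finite-dimensional module is determined up to isomorphism by the dimensions of the spaces of
homomorphisms into it. A common summand of `M` and `N` contributes equally to both dimension
functions, so it can be split off and the rest compared by induction on the dimension. -/
theorem iso_of_homDim_eq (M N : FDModule.{u, v, w} k R)
    (h : ∀ X : FDModule.{u, v, w} k R, homDim X M = homDim X N) : Iso M N := by
  induction hn : Module.finrank k M.carrier using Nat.strong_induction_on generalizing M N with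
  | _ n ih =>
  have : IsNoetherian R M.carrier := isNoetherian_of_tower k inferInstance
  have : IsArtinian R M.carrier := isArtinian_of_tower k inferInstance
  rcases subsingleton_or_nontrivial M.carrier with hM | hM
  -- If `M = 0`, then `dim End(N) = dim Hom(N, M) = 0`, hence `N = 0`.
  · have hN : Module.finrank k (N.carrier →ₗ[R] N.carrier) = 0 := by
      refine (h N).symm.trans ?_
      exact Module.finrank_zero_of_subsingleton
    have := Module.finrank_zero_iff.mp hN
    have : Subsingleton N.carrier := ⟨fun x y => by
      have hid (z : N.carrier) : z = 0 :=
        LinearMap.congr_fun (Subsingleton.elim (LinearMap.id : N.carrier →ₗ[R] N.carrier) 0) z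
      rw [hid x, hid y]⟩
    exact ⟨0⟩
  · obtain ⟨m, f, g, hgf⟩ := exists_split M N h
    obtain ⟨U, V, W, hU, ⟨e⟩, ⟨e'⟩⟩ := exists_common_summand f g hgf
    have hd : Module.finrank k V < n := by
      have h1 := (e.restrictScalars k).finrank_eq
      rw [Module.finrank_prod] at h1
      have : Nontrivial U := Submodule.nontrivial_iff_ne_bot.mpr hU
      have : 0 < Module.finrank k U := Module.finrank_pos
      omega
    obtain ⟨e''⟩ := ih _ hd (FDModule.mk V) (FDModule.mk W) (fun X => by
      have h1 := homDim_eq_add e X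
      have h2 := homDim_eq_add e' X
      have := h X
      omega) rfl
    exact ⟨e.trans (((LinearEquiv.refl R U).prodCongr e'').trans e'.symm)⟩

end FDModule
end Bongartz

/-! ### Induction along a finite field extension -/

namespace FDModule

section Induction

variable {k : Type*} {K : Type*} {Λ : Type*} [Field k] [Field K] [Algebra k K]
  [FiniteDimensional k K] [Ring Λ] [Algebra k Λ]

/-- The action of `K ⊗ Λ` on `K ⊗ X` given by `(a ⊗ l) • (b ⊗ x) = (a * b) ⊗ (l • x)`, as a
homomorphism into the `k`-linear endomorphisms. -/
noncomputable def inducedAction (X : FDModule k Λ) :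
    K ⊗[k] Λ →ₐ[k] Module.End k (K ⊗[k] X.carrier) :=
  Module.endTensorEndAlgHom.comp
    (Algebra.TensorProduct.map (Algebra.lsmul k k K) (Algebra.lsmul k k X.carrier))

/-- The `K ⊗ Λ`-module induced by a `Λ`-module `X`. It is realized on the vector space
`K ⊗[k] X`, which is canonically `(K ⊗[k] Λ) ⊗[Λ] X`. -/
noncomputable def induce (K : Type*) [Field K] [Algebra k K]
    [FiniteDimensional k K] (X : FDModule k Λ) : FDModule k (K ⊗[k] Λ) :=
  letI : Module (K ⊗[k] Λ) (K ⊗[k] X.carrier) :=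
    Module.compHom _ (inducedAction X).toRingHom
  { carrier := K ⊗[k] X.carrier
    isScalarTower := ⟨fun c r m => by
      change inducedAction X (c • r) m = c • inducedAction X r m
      rw [map_smul, LinearMap.smul_apply]⟩ }

/-- The pure tensor `a ⊗ x` as an element of the induced module. -/
def induceTmul {X : FDModule k Λ} (a : K) (x : X.carrier) : (X.induce K).carrier :=
  a ⊗ₜ[k] x

theorem tmul_smul_induceTmul {X : FDModule k Λ} (a b : K) (l : Λ) (x : X.carrier) :
    (a ⊗ₜ[k] l) • induceTmul b x = induceTmul (a * b) (l • x) :=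
  rfl

theorem induceTmul_add {X : FDModule k Λ} (a : K) (x y : X.carrier) :
    induceTmul a (x + y) = induceTmul a x + induceTmul a y :=
  TensorProduct.tmul_add a x y

theorem induce_induction {X : FDModule k Λ} {p : (X.induce K).carrier → Prop} (zero : p 0)
    (tmul : ∀ a x, p (induceTmul a x)) (add : ∀ m n, p m → p n → p (m + n)) (m) : p m :=
  TensorProduct.induction_on (motive := p) m zero tmul add

/-- The extension of a `Λ`-linear map `g : X → M` to the induced module, `a ⊗ x ↦ a • g x`. -/
noncomputable def induceLift {X : FDModule k Λ} {M : FDModule k (K ⊗[k] Λ)}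
    (g : X.carrier →ₗ[Λ] M.toBase.carrier) : (X.induce K).carrier →ₗ[K ⊗[k] Λ] M.carrier :=
  let h : X.carrier →ₗ[k] M.carrier := g.restrictScalars k
  let F : (X.induce K).carrier →ₗ[k] M.carrier := TensorProduct.lift
    (LinearMap.mk₂ k (fun (a : K) (x : X.carrier) => (a ⊗ₜ[k] (1 : Λ)) • h x)
      (fun a b x => by rw [TensorProduct.add_tmul, add_smul])
      (fun c a x => by rw [← TensorProduct.smul_tmul', smul_assoc])
      (fun a x y => by rw [map_add, smul_add])
      (fun c a x => by rw [map_smul, smul_comm]))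
  { F with
    map_smul' := fun r m => by
      change F (r • m) = r • F m
      induction r with
      | zero => rw [zero_smul, zero_smul, map_zero]
      | add r s hr hs => rw [add_smul, map_add, hr, hs, add_smul]
      | tmul b l =>
        induction m using induce_induction with
        | zero => rw [smul_zero, map_zero, smul_zero]
        | add m n hm hn => rw [smul_add, map_add, hm, hn, map_add, smul_add]
        | tmul a x =>
          change ((b * a) ⊗ₜ[k] (1 : Λ)) • h (l • x) = (b ⊗ₜ[k] l) • ((a ⊗ₜ[k] (1 : Λ)) • h x)
          have hl : h (l • x) = ((1 : K) ⊗ₜ[k] l) • h x := g.map_smul l x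
          rw [hl, smul_smul, smul_smul, Algebra.TensorProduct.tmul_mul_tmul,
            Algebra.TensorProduct.tmul_mul_tmul, mul_one, one_mul, mul_one] }

theorem induce_hom_ext {X : FDModule k Λ} {M : FDModule k (K ⊗[k] Λ)}
    {φ ψ : (X.induce K).carrier →ₗ[K ⊗[k] Λ] M.carrier}
    (h : ∀ x, φ (induceTmul 1 x) = ψ (induceTmul 1 x)) : φ = ψ := by
  ext m
  induction m using induce_induction with
  | zero => rw [map_zero, map_zero]
  | add m n hm hn => rw [map_add, map_add, hm, hn]
  | tmul a x =>
    have hax : induceTmul a x = (a ⊗ₜ[k] (1 : Λ)) • induceTmul (1 : K) x := by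
      rw [tmul_smul_induceTmul, mul_one, one_smul]
    rw [hax, map_smul, map_smul, h]

/-- Frobenius reciprocity: induction is left adjoint to restriction. -/
theorem homDim_induce (X : FDModule k Λ) (M : FDModule k (K ⊗[k] Λ)) :
    homDim (X.induce K) M = homDim X M.toBase := by
  have hone (g : X.carrier →ₗ[Λ] M.toBase.carrier) (x : X.carrier) :
      induceLift g (induceTmul 1 x) = g x :=
    one_smul (K ⊗[k] Λ) (show M.carrier from g x)
  exact LinearEquiv.finrank_eq
    { toFun := fun φ =>
        { toFun := fun x => φ (induceTmul 1 x)
          map_add' := fun x y => by rw [induceTmul_add]; exact map_add φ _ _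
          map_smul' := fun l x => by
            have hl := φ.map_smul ((1 : K) ⊗ₜ[k] l) (induceTmul 1 x)
            rw [tmul_smul_induceTmul, mul_one] at hl
            exact hl }
      invFun := induceLift
      map_add' := fun _ _ => rfl
      map_smul' := fun _ _ => rfl
      left_inv := fun φ => induce_hom_ext fun x => hone _ x
      right_inv := fun g => LinearMap.ext (hone g) }

/-- The direct sum of `n` copies of a module. -/
def pow {R : Type*} [Ring R] [Algebra k R] (X : FDModule k R) (n : ℕ) : FDModule k R where
  carrier := Fin n → X.carrier

/-- Over `Λ`, the module `K ⊗ X` is a direct sum of `[K : k]` copies of `X`, one for each element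
of a `k`-basis of `K`. -/
theorem iso_toBase_induce (X : FDModule k (K ⊗[k] Λ)) :
    Iso (X.toBase.induce K).toBase (X.pow (Module.finrank k K)).toBase := by
  let e : (X.toBase.induce K).toBase.carrier ≃ₗ[k] (Fin (Module.finrank k K) → X.toBase.carrier) :=
    TensorProduct.equivFinsuppOfBasisLeft (Module.finBasis k K) ≪≫ₗ
      Finsupp.linearEquivFunOnFinite k _ _
  have he (a : K) (x : X.toBase.carrier) (i) :
      e (induceTmul a x) i = (Module.finBasis k K).repr a i • x :=
    TensorProduct.equivFinsuppOfBasisLeft_apply_tmul_apply _ a x i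
  refine ⟨{ e with map_smul' := fun l m => ?_ }⟩
  refine induce_induction (p := fun m : (X.toBase.induce K).toBase.carrier => e (l • m) = l • e m)
    ?_ (fun a x => ?_) (fun (m n : (X.toBase.induce K).toBase.carrier) hm hn => ?_) m
  · change e (l • (0 : (X.toBase.induce K).toBase.carrier)) = l • e 0
    rw [smul_zero, map_zero, smul_zero]
  · ext i
    change e (induceTmul (1 * a) (l • x)) i = l • e (induceTmul a x) i
    rw [he, he, one_mul, smul_comm]
  · change e (l • (m + n)) = l • e (m + n)
    rw [smul_add, map_add, hm, hn, map_add, smul_add]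

end Induction
end FDModule

/-! ### Isomorphism and the Hom-order under restriction -/

namespace FDModule

theorem homDim_pow {k R : Type*} [Field k] [Ring R] [Algebra k R] (X M : FDModule k R) (n : ℕ) :
    homDim (X.pow n) M = n * homDim X M := by
  have h := finrank_pi_hom (k := k) (R := R) (ι := Fin n) (M := X.carrier) (N := M.carrier)
  rwa [Fintype.card_fin] at h

theorem Iso.symm {k R : Type*} [Field k] [Ring R] [Algebra k R] {M N : FDModule k R}
    (h : Iso M N) : Iso N M :=
  h.map LinearEquiv.symm

theorem Iso.homDim_eq {k R : Type*} [Field k] [Ring R] [Algebra k R] {M N : FDModule k R}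
    (h : Iso M N) (X : FDModule k R) : homDim M X = homDim N X := by
  obtain ⟨e⟩ := h
  exact LinearEquiv.finrank_eq
    { toFun := fun φ => φ ∘ₗ e.symm.toLinearMap
      invFun := fun φ => φ ∘ₗ e.toLinearMap
      map_add' := fun _ _ => rfl
      map_smul' := fun _ _ => rfl
      left_inv := fun φ => by ext; simp
      right_inv := fun φ => by ext; simp }

theorem Iso.homDim_eq' {k R : Type*} [Field k] [Ring R] [Algebra k R] {M N : FDModule k R}
    (h : Iso M N) (X : FDModule k R) : homDim X M = homDim X N := by
  obtain ⟨e⟩ := h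
  exact finrank_hom_congr e

theorem Iso.homLE {k : Type u} {R : Type v} [Field k] [Ring R] [Algebra k R]
    {M N : FDModule.{u, v, w} k R} (h : Iso M N) : HomLE M N :=
  fun X => (h.homDim_eq' X).le

theorem Iso.toBase {k K Λ : Type*} [Field k] [Field K] [Algebra k K] [Ring Λ] [Algebra k Λ]
    {M N : FDModule k (K ⊗[k] Λ)} (h : Iso M N) : Iso M.toBase N.toBase := by
  obtain ⟨e⟩ := h
  exact ⟨{ e with map_smul' := fun l x => e.map_smul ((1 : K) ⊗ₜ[k] l) x }⟩

end FDModule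

theorem mainTheorem2 {k : Type u} {K : Type v} {Λ : Type w}
    [Field k] [Field K] [Algebra k K] [FiniteDimensional k K] [Ring Λ] [Algebra k Λ] :
    (∀ M N : FDModule.{u, max v w, max u v} k (K ⊗[k] Λ),
        FDModule.Iso M.toBase N.toBase ↔ FDModule.Iso M N) ↔
      (∀ M N : FDModule.{u, max v w, max u v} k (K ⊗[k] Λ),
        FDModule.HomLE M.toBase N.toBase ↔ FDModule.HomLE M N) := by
  constructor
  · intro hiso M N
    constructor
    · intro h X
      -- Restricted to `Λ`, the module induced from `X` is isomorphic to a power of `X`. By hypothesis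
      -- the isomorphism lifts to `K ⊗ Λ`, and the adjunction compares the two dimensions.
      have hX (P : FDModule.{u, max v w, max u v} k (K ⊗[k] Λ)) :
          Module.finrank k K * FDModule.homDim X P = FDModule.homDim X.toBase P.toBase := by
        rw [← FDModule.homDim_induce, ← FDModule.homDim_pow]
        exact (((hiso _ _).mp (FDModule.iso_toBase_induce X)).homDim_eq P).symm
      refine Nat.le_of_mul_le_mul_left ?_ (Module.finrank_pos (R := k) (M := K))
      rw [hX, hX]
      exact h X.toBase
    · intro h X
      rw [← FDModule.homDim_induce, ← FDModule.homDim_induce]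
      exact h (X.induce K)
  · intro hle M N
    refine ⟨fun h => FDModule.iso_of_homDim_eq M N fun X => ?_, FDModule.Iso.toBase⟩
    exact ((hle M N).mp h.homLE X).antisymm ((hle N M).mp h.symm.homLE X)
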